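/- Let $2\le k\le d$ be integers. Let $S$ be a $d$-dimensional quantum system with fixed reference orthonormal basis $|1\rangle,\dots,|d\rangle$, let $A$ be an ancilla of the same dimension $d$ with its own reference basis $|1\rangle,\dots,|d\rangle$, and take the product basis $|i\rangle|j\rangle$ as the reference basis of the composite system $SA$. A state is a positive semidefinite matrix of trace one; it is incoherent if it is diagonal in the reference basis. An incoherent operation is a map $\Lambda(X)=\sum_n K_nXK_n^\dagger$ with finitely many Kraus operators such that $\sum_n K_n^\dagger K_n=\mathbb I$ and, for each $n$, $K_n\delta K_n^\dagger$ is, up to normalization, an incoherent state for every incoherent state $\delta$. For $x\in\mathbb R^d$ let $S_k(x)=\sum_{i_1<\dots<i_k}x_{i_1}\cdots x_{i_k}$. The coherence $k$-concurrence of a pure state $|\psi\rangle=\sum_i\psi_i|i\rangle$ of $S$ is $$C_c^{(k)}(|\psi\rangle)=d\Big(\tbinom dk^{-1}\sum_{i_1<\dots<i_k}|\psi_{i_1}^2\cdots\psi_{i_k}^2|\Big)^{1/k}.$$ The entanglement $k$-concurrence of a pure state of $SA$ with Schmidt decomposition $|\psi\rangle=\sum_{i=1}^d\sqrt{\lambda_i}\,|a_i\rangle|b_i\rangle$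 is $$E_c^{(k)}(|\psi\rangle)=\Big(\frac{S_k(\lambda)}{S_k(1/d,\dots,1/d)}\Big)^{1/k}.$$ Both are extended to mixed states by the convex roof: the value at $\rho$ is the infimum (which is attained) of $\sum_a p_a f(|\psi_a\rangle)$, where $f$ is the corresponding pure-state function, over all finite decompositions $\rho=\sum_a p_a|\psi_a\rangle\langle\psi_a|$ with unit vectors $|\psi_a\rangle$, $p_a\ge0$ and $\sum_a p_a=1$. Then for every state $\rho$ of $S$ there is an incoherent operation $\Lambda$ on $SA$ with $$E_c^{(k)}\big(\Lambda[\rho\otimes|1\rangle\langle1|]\big)\neq0$$ if and only if $C_c^{(k)}(\rho)\neq0$. -/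

import Mathlib

open scoped Kronecker Matrix ComplexOrder

noncomputable section

/-- The pure-state projector `|ψ⟩⟨ψ|`. -/
def ketBra {ι : Type*} [Fintype ι] (ψ : EuclideanSpace ℂ ι) : Matrix ι ι ℂ :=
  Matrix.of fun i j => ψ i * star (ψ j)

/-- A (mixed) quantum state: a positive semidefinite matrix of trace one. -/
def IsState {ι : Type*} [Fintype ι] (ρ : Matrix ι ι ℂ) : Prop :=
  ρ.PosSemidef ∧ ρ.trace = 1

/-- An incoherent state: a state that is diagonal in the reference basis, the standard basis
indexed by `ι`. -/
def IsIncoherentState {ι : Type*} [Fintype ι] (δ : Matrix ι ι ℂ) : Prop :=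
  IsState δ ∧ δ.IsDiag

/-- An incoherent Kraus operator maps every incoherent state to an incoherent state, up to
normalization (`K δ K†` is a nonnegative multiple, possibly zero, of an incoherent state). -/
def IsIncoherentKraus {ι : Type*} [Fintype ι] (K : Matrix ι ι ℂ) : Prop :=
  ∀ δ : Matrix ι ι ℂ, IsIncoherentState δ →
    ∃ c : ℝ, 0 ≤ c ∧ ∃ σ : Matrix ι ι ℂ, IsIncoherentState σ ∧ K * δ * Kᴴ = (c : ℂ) • σ

/-- An incoherent operation: a map `X ↦ ∑ₙ Kₙ X Kₙ†` with finitely many incoherent Kraus operators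
satisfying `∑ₙ Kₙ† Kₙ = 1`. -/
def IsIncoherentOperation {ι : Type*} [Fintype ι] [DecidableEq ι]
    (L : Matrix ι ι ℂ →ₗ[ℂ] Matrix ι ι ℂ) : Prop :=
  ∃ (N : ℕ) (K : Fin N → Matrix ι ι ℂ),
    ∑ n, (K n)ᴴ * K n = 1 ∧ (∀ n, IsIncoherentKraus (K n)) ∧
      ∀ X, L X = ∑ n, K n * X * (K n)ᴴ

/-- `(p, ψ)` is a finite decomposition of `ρ` into pure states:
`ρ = ∑ₐ pₐ |ψₐ⟩⟨ψₐ|` with `pₐ ≥ 0`, `∑ₐ pₐ = 1` and unit vectors `ψₐ`. -/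
structure IsPureDecomposition {ι : Type*} [Fintype ι] {m : ℕ} (ρ : Matrix ι ι ℂ)
    (p : Fin m → ℝ) (ψ : Fin m → EuclideanSpace ℂ ι) : Prop where
  nonneg : ∀ a, 0 ≤ p a
  sum_eq_one : ∑ a, p a = 1
  norm_eq_one : ∀ a, ‖ψ a‖ = 1
  eq_sum : ρ = ∑ a, (p a : ℂ) • ketBra (ψ a)

/-- The convex roof extension of a function on pure states: the least average of `f` over all
pure-state decompositions of `ρ`, taken as an infimum. -/
def convexRoof {ι : Type*} [Fintype ι] (f : EuclideanSpace ℂ ι → ℝ) (ρ : Matrix ι ι ℂ) : ℝ :=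
  sInf {x : ℝ | ∃ (m : ℕ) (p : Fin m → ℝ) (ψ : Fin m → EuclideanSpace ℂ ι),
    IsPureDecomposition ρ p ψ ∧ x = ∑ a, p a * f (ψ a)}

/-- Every state has a pure-state decomposition, so the infimum in `convexRoof` is over a nonempty
set. -/
theorem IsState.exists_isPureDecomposition {d : Type*} [Fintype d] [DecidableEq d]
    {ρ : Matrix d d ℂ} (h : IsState ρ) :
    ∃ (m : ℕ) (p : Fin m → ℝ) (ψ : Fin m → EuclideanSpace ℂ d), IsPureDecomposition ρ p ψ := by
  have hH := h.1.isHermitian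
  let e := (Fintype.equivFin d).symm
  refine ⟨Fintype.card d, fun a => hH.eigenvalues (e a), fun a => hH.eigenvectorBasis (e a),
    fun a => h.1.eigenvalues_nonneg _, ?_, fun a => hH.eigenvectorBasis.orthonormal.1 _, ?_⟩
  · rw [e.sum_comp (fun i => hH.eigenvalues i)]
    have hs : ((∑ i, hH.eigenvalues i : ℝ) : ℂ) = 1 := by
      rw [← h.2, hH.trace_eq_sum_eigenvalues]
      simp
    exact Complex.ofReal_eq_one.mp hs
  · rw [e.sum_comp (fun i => (hH.eigenvalues i : ℂ) • ketBra (hH.eigenvectorBasis i))]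
    conv_lhs => rw [hH.spectral_theorem]
    ext i j
    simp [Unitary.conjStarAlgAut_apply, Matrix.mul_apply, Matrix.diagonal_apply, Matrix.sum_apply,
      ketBra, Matrix.star_apply]
    refine Finset.sum_congr rfl fun x _ => ?_
    ring

/-- The elementary symmetric polynomial `S_k` of `d` real variables. -/
def elemSymm {d : ℕ} (k : ℕ) (l : Fin d → ℝ) : ℝ :=
  ∑ s ∈ (Finset.univ : Finset (Fin d)).powersetCard k, ∏ i ∈ s, l i

/-- The coefficient matrix `(ψ_{ij})` of a bipartite vector `∑ ψ_{ij} |i⟩|j⟩`. -/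
def coeffMatrix {d : ℕ} (ψ : EuclideanSpace ℂ (Fin d × Fin d)) : Matrix (Fin d) (Fin d) ℂ :=
  Matrix.of fun i j => ψ (i, j)

/-- The Schmidt coefficients `l i` of a bipartite vector, `ψ = ∑ᵢ √(l i) |aᵢ⟩|bᵢ⟩` with orthonormal
`a`, `b`: the eigenvalues, with multiplicity, of the reduced matrix
`Tr_B |ψ⟩⟨ψ| = M M†` where `M` is the coefficient matrix of `ψ`. -/
def schmidtCoeff {d : ℕ} (ψ : EuclideanSpace ℂ (Fin d × Fin d)) : Fin d → ℝ :=
  (Matrix.isHermitian_mul_conjTranspose_self (coeffMatrix ψ)).eigenvalues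

/-- The entanglement `k`-concurrence of a pure state of a `d × d` system. -/
def pureEntanglementConcurrence {d : ℕ} (k : ℕ) (ψ : EuclideanSpace ℂ (Fin d × Fin d)) : ℝ :=
  (elemSymm k (schmidtCoeff ψ) / elemSymm k (fun _ : Fin d => 1 / (d : ℝ))) ^ (1 / (k : ℝ))

/-- The entanglement `k`-concurrence `E_c^{(k)}` of a state of a `d × d` system. -/
def entanglementConcurrence {d : ℕ} (k : ℕ)
    (ρ : Matrix (Fin d × Fin d) (Fin d × Fin d) ℂ) : ℝ :=
  convexRoof (pureEntanglementConcurrence k) ρ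

/-- The coherence `k`-concurrence of a pure state of a `d`-dimensional system. -/
def pureCoherenceConcurrence {d : ℕ} (k : ℕ) (ψ : EuclideanSpace ℂ (Fin d)) : ℝ :=
  d * (1 / (d.choose k : ℝ) *
    ∑ s ∈ (Finset.univ : Finset (Fin d)).powersetCard k, ‖∏ i ∈ s, ψ i ^ 2‖) ^ (1 / (k : ℝ))

/-- The coherence `k`-concurrence `C_c^{(k)}` of a state of a `d`-dimensional system. -/
def coherenceConcurrence {d : ℕ} (k : ℕ) (ρ : Matrix (Fin d) (Fin d) ℂ) : ℝ :=
  convexRoof (pureCoherenceConcurrence k) ρ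

/-- The projector `|i⟩⟨i|` onto a reference basis vector. -/
def basisState {d : ℕ} (i : Fin d) : Matrix (Fin d) (Fin d) ℂ :=
  ketBra (EuclideanSpace.single i 1)

end

/-! On pure states the coherence `k`-concurrence is zero only if fewer than `k` amplitudes are
nonzero, and the entanglement one is zero once the Schmidt rank is below `k`.

If `C_c^{(k)}(ρ) = 0`, then, because the convex roof is attained, `ρ` is a mixture of vectors with
fewer than `k` nonzero coordinates. Columns of an incoherent Kraus operator have at most one nonzero
entry, so supports do not grow, and a bipartite vector has Schmidt rank at most the size of its
support. The output thus decomposes into vectors of zero entanglement `k`-concurrence.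

Conversely, the basis permutation `|i⟩|1⟩ ↦ |i⟩|i⟩` is incoherent. Every vector of positive weight
in a decomposition of its output lies in the span of the `|i⟩|i⟩`, where the two pure-state
functions agree, so the decomposition pulls back to one of `ρ` with the same average. Hence the
output has entanglement at least `C_c^{(k)}(ρ)`. -/

/-! ### Attainment of the convex roof -/

/-- In a finite-dimensional real topological vector space, the convex hull of a compact set is
compact. -/
theorem IsCompact.convexHull_of_finiteDimensional {E : Type*} [AddCommGroup E] [Module ℝ E]
    [TopologicalSpace E] [ContinuousAdd E] [ContinuousSMul ℝ E] [FiniteDimensional ℝ E]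
    {s : Set E} (hs : IsCompact s) : IsCompact (convexHull ℝ s) := by
  rcases s.eq_empty_or_nonempty with rfl | ⟨x₀, hx₀⟩
  · simp
  -- By Carathéodory, this many points suffice for every convex combination.
  let n := Module.finrank ℝ E + 1
  have hF : Continuous fun q : (Fin n → ℝ) × (Fin n → E) => ∑ i, q.1 i • q.2 i := by fun_prop
  have hc : IsCompact (stdSimplex ℝ (Fin n) ×ˢ Set.univ.pi fun _ : Fin n => s) :=
    (isCompact_stdSimplex ℝ (Fin n)).prod (isCompact_univ_pi fun _ => hs)
  convert hc.image hF using 1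
  ext x
  constructor
  · intro hx
    obtain ⟨ι, _, z, w, hz, hind, hw, hw1, hx⟩ := eq_pos_convex_span_of_mem_convexHull hx
    obtain ⟨e⟩ : Nonempty (ι ↪ Fin n) := by
      apply Function.Embedding.nonempty_of_card_le
      simpa [n] using hind.card_le_finrank_succ.trans
        (Nat.succ_le_succ (Submodule.finrank_le _))
    -- Shorter combinations are padded with weight `0` at the point `x₀`.
    have hw0 : ∀ j, j ∉ Set.range e → Function.extend e w 0 j = 0 := fun j hj => by
      rw [Function.extend_apply' _ _ _ (by simpa using hj)]; rfl
    refine ⟨(Function.extend e w 0, Function.extend e z fun _ => x₀), ⟨⟨fun j => ?_, ?_⟩,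
      fun j _ => ?_⟩, ?_⟩
    · by_cases hj : j ∈ Set.range e
      · obtain ⟨i, rfl⟩ := hj
        simpa [e.injective.extend_apply] using (hw i).le
      · exact (hw0 j hj).ge
    · rw [Fintype.sum_of_injective e e.injective w _ hw0
        fun i => (e.injective.extend_apply _ _ _).symm] at hw1
      exact hw1
    · by_cases hj : j ∈ Set.range e
      · obtain ⟨i, rfl⟩ := hj
        simpa [e.injective.extend_apply] using hz ⟨i, rfl⟩
      · simpa [Function.extend_apply' _ _ _ (show ¬∃ i, e i = j by simpa using hj)] using hx₀
    · rw [← hx]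
      refine (Fintype.sum_of_injective e e.injective _ _ (fun j hj => ?_) fun i => ?_).symm
      · simp [hw0 j hj]
      · simp [e.injective.extend_apply]
  · rintro ⟨⟨w, z⟩, ⟨hw, hz⟩, rfl⟩
    exact mem_convexHull_of_exists_fintype w z hw.1 hw.2 (fun i => hz i trivial) rfl

theorem continuous_ketBra {ι : Type*} [Fintype ι] :
    Continuous (ketBra : EuclideanSpace ℂ ι → Matrix ι ι ℂ) := by
  refine continuous_matrix fun i j => ?_
  simp only [ketBra, Matrix.of_apply]
  fun_prop

/-- The convex roof of a continuous function is attained. -/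
theorem exists_isPureDecomposition_convexRoof_eq {ι : Type*} [Fintype ι] [DecidableEq ι]
    {f : EuclideanSpace ℂ ι → ℝ} (hf : Continuous f) {ρ : Matrix ι ι ℂ} (hρ : IsState ρ) :
    ∃ (m : ℕ) (p : Fin m → ℝ) (ψ : Fin m → EuclideanSpace ℂ ι),
      IsPureDecomposition ρ p ψ ∧ convexRoof f ρ = ∑ a, p a * f (ψ a) := by
  -- Decompositions of `ρ` with their averages are the points over `ρ` in the convex hull of this
  -- compact graph.
  let G : Set (Matrix ι ι ℂ × ℝ) :=
    (fun ψ => (ketBra ψ, f ψ)) '' Metric.sphere (0 : EuclideanSpace ℂ ι) 1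
  have hG : IsCompact (convexHull ℝ G) :=
    ((isCompact_sphere _ _).image (continuous_ketBra.prodMk hf)).convexHull_of_finiteDimensional
  let S : Set ℝ := {x : ℝ | ∃ (m : ℕ) (p : Fin m → ℝ) (ψ : Fin m → EuclideanSpace ℂ ι),
    IsPureDecomposition ρ p ψ ∧ x = ∑ a, p a * f (ψ a)}
  have hS : S = Prod.snd '' (convexHull ℝ G ∩ Prod.fst ⁻¹' {ρ}) := by
    ext x
    constructor
    · rintro ⟨m, p, ψ, h, rfl⟩
      refine ⟨(ρ, _), ⟨mem_convexHull_of_exists_fintype p (fun a => (ketBra (ψ a), f (ψ a)))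
        h.nonneg h.sum_eq_one (fun a => ⟨ψ a, by simp [h.norm_eq_one], rfl⟩) ?_, rfl⟩, rfl⟩
      refine Prod.ext ?_ ?_
      · simp [Prod.fst_sum, h.eq_sum]
      · rw [Prod.snd_sum]
        exact Finset.sum_congr rfl fun a _ => rfl
    · rintro ⟨⟨σ, y⟩, ⟨hy, rfl⟩, rfl⟩
      obtain ⟨κ, _, w, z, hw, hw1, hz, hsum⟩ := mem_convexHull_iff_exists_fintype.1 hy
      choose φ hφ hφz using hz
      let e := (Fintype.equivFin κ).symm
      have hsum' : ∑ i, w i • (ketBra (φ i), f (φ i)) = (σ, y) := by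
        rw [← hsum]
        exact Finset.sum_congr rfl fun i _ => by rw [← hφz i]
      refine ⟨Fintype.card κ, w ∘ e, φ ∘ e, ⟨fun a => hw _, ?_, fun a => ?_, ?_⟩, ?_⟩
      · rw [← hw1]; exact e.sum_comp w
      · simpa using hφ (e a)
      · have := congrArg Prod.fst hsum'
        simp only [Prod.fst_sum, Prod.smul_fst] at this
        refine this.symm.trans ?_
        rw [← e.sum_comp]
        simp
      · have := congrArg Prod.snd hsum'
        simp only [Prod.snd_sum, Prod.smul_snd, smul_eq_mul] at this
        refine this.symm.trans ?_
        rw [← e.sum_comp]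
        simp
  have hSc : IsCompact S := by
    rw [hS]
    exact (hG.inter_right (isClosed_singleton.preimage continuous_fst)).image continuous_snd
  have hne : S.Nonempty := by
    obtain ⟨m, p, ψ, h⟩ := hρ.exists_isPureDecomposition
    exact ⟨_, m, p, ψ, h, rfl⟩
  exact hSc.sInf_mem hne

theorem convexRoof_nonneg {ι : Type*} [Fintype ι] {f : EuclideanSpace ℂ ι → ℝ}
    (hf : ∀ ψ, 0 ≤ f ψ) (ρ : Matrix ι ι ℂ) : 0 ≤ convexRoof f ρ := by
  refine Real.sInf_nonneg ?_
  rintro x ⟨m, p, ψ, h, rfl⟩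
  exact Finset.sum_nonneg fun a _ => mul_nonneg (h.nonneg a) (hf _)

/-! ### Unnormalized projectors -/

theorem trace_ketBra {ι : Type*} [Fintype ι] (ψ : EuclideanSpace ℂ ι) :
    (ketBra ψ).trace = ((‖ψ‖ ^ 2 : ℝ) : ℂ) := by
  simp only [Matrix.trace, ketBra, Matrix.diag_apply, Matrix.of_apply, EuclideanSpace.norm_sq_eq,
    Complex.ofReal_sum]
  exact Finset.sum_congr rfl fun i _ => by simp [Complex.mul_conj, Complex.normSq_eq_norm_sq]

theorem ketBra_smul {ι : Type*} [Fintype ι] (c : ℂ) (ψ : EuclideanSpace ℂ ι) :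
    ketBra (c • ψ) = ((‖c‖ ^ 2 : ℝ) : ℂ) • ketBra ψ := by
  ext i j
  have : c * star c = ((‖c‖ ^ 2 : ℝ) : ℂ) := by
    simp [Complex.mul_conj, Complex.normSq_eq_norm_sq]
  simp only [ketBra, Matrix.of_apply, Matrix.smul_apply, PiLp.smul_apply, smul_eq_mul, star_mul',
    ← this]
  ring

theorem posSemidef_ketBra {ι : Type*} [Fintype ι] (ψ : EuclideanSpace ℂ ι) :
    (ketBra ψ).PosSemidef :=
  Matrix.posSemidef_vecMulVec_self_star (ψ : ι → ℂ)

/-- If a unit-trace matrix is a sum of unnormalized projectors on vectors whose normalizations are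
zeros of a nonnegative `f`, then the convex roof of `f` vanishes at it. -/
theorem convexRoof_eq_zero_of_eq_sum_ketBra {ι κ : Type*} [Fintype ι] [Fintype κ]
    {f : EuclideanSpace ℂ ι → ℝ} (hf : ∀ ψ, 0 ≤ f ψ) {σ : Matrix ι ι ℂ} (htr : σ.trace = 1)
    (v : κ → EuclideanSpace ℂ ι) (hσ : σ = ∑ j, ketBra (v j))
    (hv : ∀ j, v j ≠ 0 → f (((‖v j‖⁻¹ : ℝ) : ℂ) • v j) = 0) : convexRoof f σ = 0 := by
  classical
  have hne : Nonempty ι := by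
    by_contra h
    rw [not_nonempty_iff] at h
    simp [Matrix.trace] at htr
  obtain ⟨i₀⟩ := hne
  let u : EuclideanSpace ℂ ι := EuclideanSpace.single i₀ 1
  -- A zero vector cannot be normalized; any unit vector serves, as its weight `‖v j‖ ^ 2` is zero.
  let φ : κ → EuclideanSpace ℂ ι := fun j => if v j = 0 then u else ((‖v j‖⁻¹ : ℝ) : ℂ) • v j
  let e := (Fintype.equivFin κ).symm
  refine le_antisymm (csInf_le ⟨0, ?_⟩ ?_) (convexRoof_nonneg hf σ)
  · rintro x ⟨m, p, ψ, h, rfl⟩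
    exact Finset.sum_nonneg fun a _ => mul_nonneg (h.nonneg a) (hf _)
  refine ⟨Fintype.card κ, fun a => ‖v (e a)‖ ^ 2, fun a => φ (e a),
    ⟨fun a => by positivity, ?_, fun a => ?_, ?_⟩, ?_⟩
  · rw [e.sum_comp fun j => ‖v j‖ ^ 2]
    rw [hσ, Matrix.trace_sum] at htr
    simp only [trace_ketBra] at htr
    exact_mod_cast htr
  · by_cases h : v (e a) = 0
    · simp [φ, h, u]
    · have : ‖v (e a)‖ ≠ 0 := norm_ne_zero_iff.2 h
      simp [φ, h, norm_smul, this]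
  · rw [e.sum_comp fun j => ((‖v j‖ ^ 2 : ℝ) : ℂ) • ketBra (φ j), hσ]
    refine Finset.sum_congr rfl fun j _ => ?_
    by_cases h : v j = 0
    · ext a b
      simp [h, ketBra]
    · have h' : ‖v j‖ ≠ 0 := norm_ne_zero_iff.2 h
      simp only [φ, h, if_false, ketBra_smul, smul_smul]
      rw [← Complex.ofReal_mul]
      simp [h']
  · symm
    refine Finset.sum_eq_zero fun a _ => ?_
    by_cases h : v (e a) = 0
    · simp [h]
    · simp only [φ, h, if_false]
      rw [hv _ h, mul_zero]

/-! ### Concurrences of pure states -/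

theorem schmidtCoeff_nonneg {d : ℕ} (ψ : EuclideanSpace ℂ (Fin d × Fin d)) (i : Fin d) :
    0 ≤ schmidtCoeff ψ i :=
  (Matrix.posSemidef_self_mul_conjTranspose (coeffMatrix ψ)).eigenvalues_nonneg i

theorem elemSymm_nonneg {d : ℕ} (k : ℕ) {l : Fin d → ℝ} (hl : ∀ i, 0 ≤ l i) :
    0 ≤ elemSymm k l :=
  Finset.sum_nonneg fun _ _ => Finset.prod_nonneg fun i _ => hl i

theorem elemSymm_const {d : ℕ} (k : ℕ) (c : ℝ) :
    elemSymm k (fun _ : Fin d => c) = d.choose k * c ^ k := by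
  rw [elemSymm, Finset.sum_congr rfl fun s hs => by
    rw [Finset.prod_const, (Finset.mem_powersetCard.1 hs).2]]
  simp

/-- Makes visible that only the multiset of values matters, so the ordering of the eigenvalues is
irrelevant. -/
theorem elemSymm_eq_esymm {d : ℕ} (k : ℕ) (l : Fin d → ℝ) :
    elemSymm k l = (Finset.univ.val.map l).esymm k :=
  (Finset.esymm_map_val l Finset.univ k).symm

theorem pureEntanglementConcurrence_nonneg {d : ℕ} (k : ℕ)
    (ψ : EuclideanSpace ℂ (Fin d × Fin d)) : 0 ≤ pureEntanglementConcurrence k ψ :=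
  Real.rpow_nonneg (div_nonneg (elemSymm_nonneg k (schmidtCoeff_nonneg ψ))
    (elemSymm_nonneg k fun _ => by positivity)) _

/-- A bipartite vector with fewer than `k` nonzero coordinates has vanishing entanglement
`k`-concurrence. -/
theorem pureEntanglementConcurrence_eq_zero {d k : ℕ} (hk : k ≠ 0)
    {ψ : EuclideanSpace ℂ (Fin d × Fin d)} {t : Finset (Fin d × Fin d)} (ht : t.card < k)
    (hψ : ∀ r, ψ r ≠ 0 → r ∈ t) : pureEntanglementConcurrence k ψ = 0 := by
  classical
  -- The rank is at most the number of nonzero rows, and it counts the nonzero Schmidt coefficients.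
  have hrank : (coeffMatrix ψ * (coeffMatrix ψ)ᴴ).rank < k := by
    rw [Matrix.rank_self_mul_conjTranspose]
    refine lt_of_le_of_lt (Matrix.rank_le_card_of_support_subset _ (t.image Prod.fst) ?_)
      (Finset.card_image_le.trans_lt ht)
    intro i hi
    obtain ⟨j, hj⟩ := Function.ne_iff.1 hi
    exact Finset.mem_coe.2 (Finset.mem_image.2 ⟨(i, j), hψ _ hj, rfl⟩)
  rw [(Matrix.isHermitian_mul_conjTranspose_self (coeffMatrix ψ)).rank_eq_card_non_zero_eigs,
    Fintype.card_subtype] at hrank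
  have h0 : elemSymm k (schmidtCoeff ψ) = 0 := by
    refine Finset.sum_eq_zero fun s hs => ?_
    by_contra hne
    rw [← ne_eq, Finset.prod_ne_zero_iff] at hne
    refine absurd (Finset.card_le_card (s := s) fun i hi => ?_)
      (not_le.2 (hrank.trans_eq (Finset.mem_powersetCard.1 hs).2.symm))
    exact Finset.mem_filter.2 ⟨Finset.mem_univ _, hne i hi⟩
  rw [pureEntanglementConcurrence, h0, zero_div, Real.zero_rpow (by positivity)]

theorem pureCoherenceConcurrence_eq {d : ℕ} (k : ℕ) (ψ : EuclideanSpace ℂ (Fin d)) :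
    pureCoherenceConcurrence k ψ =
      d * (1 / (d.choose k : ℝ) * elemSymm k fun i => ‖ψ i‖ ^ 2) ^ (1 / (k : ℝ)) := by
  simp [pureCoherenceConcurrence, elemSymm]

theorem pureCoherenceConcurrence_nonneg {d : ℕ} (k : ℕ) (ψ : EuclideanSpace ℂ (Fin d)) :
    0 ≤ pureCoherenceConcurrence k ψ := by
  rw [pureCoherenceConcurrence_eq]
  have := elemSymm_nonneg k (l := fun i => ‖ψ i‖ ^ 2) fun _ => by positivity
  positivity

theorem continuous_pureCoherenceConcurrence {d : ℕ} (k : ℕ) :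
    Continuous (pureCoherenceConcurrence k : EuclideanSpace ℂ (Fin d) → ℝ) := by
  unfold pureCoherenceConcurrence
  refine continuous_const.mul (Continuous.rpow_const ?_ fun _ => Or.inr (by positivity))
  fun_prop

/-- A vector with vanishing coherence `k`-concurrence has fewer than `k` nonzero coordinates. -/
theorem card_support_lt_of_pureCoherenceConcurrence_eq_zero {d k : ℕ} (hk : k ≠ 0) (hkd : k ≤ d)
    {ψ : EuclideanSpace ℂ (Fin d)} (h : pureCoherenceConcurrence k ψ = 0) :
    (Finset.univ.filter fun i => ψ i ≠ 0).card < k := by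
  by_contra! hc
  obtain ⟨s, hs, hsk⟩ := Finset.exists_subset_card_eq hc
  have hpos : 0 < elemSymm k fun i => ‖ψ i‖ ^ 2 := by
    refine Finset.sum_pos' (fun _ _ => Finset.prod_nonneg fun i _ => by positivity)
      ⟨s, Finset.mem_powersetCard.2 ⟨Finset.subset_univ _, hsk⟩, Finset.prod_pos fun i hi => ?_⟩
    have := norm_pos_iff.2 (Finset.mem_filter.1 (hs hi)).2
    positivity
  have hch : (0 : ℝ) < d.choose k := by exact_mod_cast Nat.choose_pos hkd
  have hd : (0 : ℝ) < d := by exact_mod_cast (Nat.pos_of_ne_zero hk).trans_le hkd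
  rw [pureCoherenceConcurrence_eq] at h
  exact absurd h (by positivity)

/-- On vectors `∑ᵢ φᵢ |i⟩|i⟩` the entanglement concurrence is the coherence concurrence of `φ`. -/
theorem pureEntanglementConcurrence_of_diagonal {d k : ℕ} (hk : k ≠ 0) (hkd : k ≤ d)
    {ψ : EuclideanSpace ℂ (Fin d × Fin d)} {φ : EuclideanSpace ℂ (Fin d)}
    (h : coeffMatrix ψ = Matrix.diagonal φ) :
    pureEntanglementConcurrence k ψ = pureCoherenceConcurrence k φ := by
  have hd : (0 : ℝ) < d := by exact_mod_cast (Nat.pos_of_ne_zero hk).trans_le hkd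
  have hprod : coeffMatrix ψ * (coeffMatrix ψ)ᴴ =
      Matrix.diagonal fun i => ((‖φ i‖ ^ 2 : ℝ) : ℂ) := by
    rw [h, Matrix.diagonal_conjTranspose, Matrix.diagonal_mul_diagonal]
    congr 1
    ext i
    simp [Complex.mul_conj, Complex.normSq_eq_norm_sq]
  have hroots : Finset.univ.val.map (schmidtCoeff ψ) =
      Finset.univ.val.map fun i => ‖φ i‖ ^ 2 := by
    have h1 := (Matrix.isHermitian_mul_conjTranspose_self
      (coeffMatrix ψ)).roots_charpoly_eq_eigenvalues
    rw [congrArg Matrix.charpoly hprod, Matrix.charpoly_diagonal,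
      Polynomial.roots_prod _ _ (Finset.prod_ne_zero_iff.2 fun i _ => Polynomial.X_sub_C_ne_zero _)]
      at h1
    simp only [Polynomial.roots_X_sub_C, Multiset.bind_singleton] at h1
    refine Multiset.map_injective Complex.ofReal_injective ?_
    rw [Multiset.map_map, Multiset.map_map]
    exact h1.symm
  have hsymm : elemSymm k (schmidtCoeff ψ) = elemSymm k fun i => ‖φ i‖ ^ 2 := by
    rw [elemSymm_eq_esymm, hroots, ← elemSymm_eq_esymm]
  have hnn : 0 ≤ elemSymm k fun i => ‖φ i‖ ^ 2 := elemSymm_nonneg k fun _ => by positivity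
  rw [pureEntanglementConcurrence, pureCoherenceConcurrence_eq, hsymm, elemSymm_const]
  -- The `k`-th root of `d ^ k` is the prefactor `d` of the coherence concurrence.
  have : (elemSymm k fun i => ‖φ i‖ ^ 2) / (d.choose k * (1 / (d : ℝ)) ^ k) =
      (d : ℝ) ^ k * (1 / (d.choose k : ℝ) * elemSymm k fun i => ‖φ i‖ ^ 2) := by
    have : (0 : ℝ) < d.choose k := by exact_mod_cast Nat.choose_pos hkd
    rw [one_div_pow]
    field_simp
  rw [this, Real.mul_rpow (by positivity) (by positivity), one_div (k : ℝ),
    Real.pow_rpow_inv_natCast hd.le hk]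

/-! ### Incoherent operations and supports -/

/-- An incoherent Kraus operator has at most one nonzero entry in each column. -/
theorem IsIncoherentKraus.eq_of_apply_ne_zero {ι : Type*} [Fintype ι] [DecidableEq ι]
    {K : Matrix ι ι ℂ} (hK : IsIncoherentKraus K) {r s c : ι} (hr : K r c ≠ 0) (hs : K s c ≠ 0) :
    r = s := by
  by_contra hrs
  -- Testing on `|c⟩⟨c|` gives the entry `K r c * star (K s c)`, which must vanish off the diagonal.
  have hδ : IsIncoherentState (Matrix.single c c (1 : ℂ)) := by
    have h : Matrix.single c c (1 : ℂ) = ketBra (EuclideanSpace.single c 1) := by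
      ext i j
      by_cases hi : c = i <;> by_cases hj : c = j <;>
        simp [ketBra, Matrix.single_apply, hi, hj, eq_comm]
    refine ⟨⟨h ▸ posSemidef_ketBra _, by simp⟩, fun i j hij => ?_⟩
    refine Matrix.single_apply_of_ne _ _ _ _ _ ?_
    rintro ⟨rfl, rfl⟩
    exact hij rfl
  obtain ⟨a, -, σ, hσ, h⟩ := hK _ hδ
  have h' := congrFun (congrFun h r) s
  rw [Matrix.smul_apply, hσ.2 hrs, smul_zero] at h'
  have : (K * Matrix.single c c (1 : ℂ) * Kᴴ) r s = K r c * star (K s c) := by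
    simp [Matrix.mul_apply, Matrix.single_apply, ite_and]
  rw [this] at h'
  exact mul_ne_zero hr (star_ne_zero.2 hs) h'

/-- An incoherent Kraus operator does not increase the number of nonzero coordinates. -/
theorem IsIncoherentKraus.card_support_mulVec_le {ι : Type*} [Fintype ι] [DecidableEq ι]
    {K : Matrix ι ι ℂ} (hK : IsIncoherentKraus K) (v : ι → ℂ) :
    (Finset.univ.filter fun r => (K *ᵥ v) r ≠ 0).card ≤
      (Finset.univ.filter fun c => v c ≠ 0).card := by
  -- Each nonzero coordinate `r` of the image is fed by some `c` in the support of `v`, and `c`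
  -- determines `r`.
  refine Finset.card_le_card_of_forall_subsingleton (fun r c => K r c ≠ 0) (fun r hr => ?_)
    fun c _ r hr s hs => hK.eq_of_apply_ne_zero hr.2 hs.2
  obtain ⟨c, -, hc⟩ := Finset.exists_ne_zero_of_sum_ne_zero (Finset.mem_filter.1 hr).2
  exact ⟨c, Finset.mem_filter.2 ⟨Finset.mem_univ _, right_ne_zero_of_mul hc⟩,
    left_ne_zero_of_mul hc⟩

theorem ketBra_eq_vecMulVec {ι : Type*} [Fintype ι] (ψ : EuclideanSpace ℂ ι) :
    ketBra ψ = Matrix.vecMulVec ψ (star (ψ : ι → ℂ)) := rfl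

theorem mul_ketBra_mul_conjTranspose {ι : Type*} [Fintype ι] (K : Matrix ι ι ℂ)
    (ψ : EuclideanSpace ℂ ι) : K * ketBra ψ * Kᴴ = ketBra (WithLp.toLp 2 (K *ᵥ ψ)) := by
  rw [ketBra_eq_vecMulVec, ketBra_eq_vecMulVec, Matrix.mul_vecMulVec, Matrix.vecMulVec_mul,
    Matrix.star_mulVec]

theorem trace_sum_conj {ι κ : Type*} [Fintype ι] [DecidableEq ι] [Fintype κ]
    {K : κ → Matrix ι ι ℂ} (hK : ∑ n, (K n)ᴴ * K n = 1) (X : Matrix ι ι ℂ) :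
    (∑ n, K n * X * (K n)ᴴ).trace = X.trace := by
  rw [Matrix.trace_sum]
  simp_rw [fun n => Matrix.trace_mul_comm (K n * X) (K n)ᴴ, ← Matrix.mul_assoc]
  rw [← Matrix.trace_sum, ← Finset.sum_mul, hK, Matrix.one_mul]

theorem IsIncoherentOperation.isState {ι : Type*} [Fintype ι] [DecidableEq ι]
    {L : Matrix ι ι ℂ →ₗ[ℂ] Matrix ι ι ℂ} (hL : IsIncoherentOperation L) {X : Matrix ι ι ℂ}
    (hX : IsState X) : IsState (L X) := by
  obtain ⟨N, K, hK, -, hLK⟩ := hL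
  rw [hLK]
  exact ⟨Matrix.posSemidef_sum _ fun n _ => hX.1.mul_mul_conjTranspose_same _,
    (trace_sum_conj hK X).trans hX.2⟩

/-- The product vector `|ψ⟩|z⟩` with a reference basis vector of the ancilla. -/
def attachBasisVec {d : ℕ} (z : Fin d) (ψ : EuclideanSpace ℂ (Fin d)) :
    EuclideanSpace ℂ (Fin d × Fin d) :=
  WithLp.toLp 2 fun r => if r.2 = z then ψ r.1 else 0

theorem basisState_apply {d : ℕ} (z i j : Fin d) :
    basisState z i j = if i = z ∧ j = z then 1 else 0 := by
  by_cases hi : i = z <;> by_cases hj : j = z <;> simp [basisState, ketBra, hi, hj]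

theorem ketBra_attachBasisVec {d : ℕ} (z : Fin d) (ψ : EuclideanSpace ℂ (Fin d)) :
    ketBra (attachBasisVec z ψ) = ketBra ψ ⊗ₖ basisState z := by
  ext ⟨i, a⟩ ⟨j, b⟩
  rw [Matrix.kronecker_apply, basisState_apply]
  by_cases ha : a = z <;> by_cases hb : b = z <;> simp [ketBra, attachBasisVec, ha, hb]

theorem card_support_attachBasisVec_le {d : ℕ} (z : Fin d) (ψ : EuclideanSpace ℂ (Fin d)) :
    (Finset.univ.filter fun r => attachBasisVec z ψ r ≠ 0).card ≤
      (Finset.univ.filter fun i => ψ i ≠ 0).card := by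
  refine Finset.card_le_card_of_injOn Prod.fst (fun r hr => ?_) fun r hr s hs h => ?_
  · by_cases h : r.2 = z <;> simp_all [attachBasisVec]
  · by_cases h1 : r.2 = z <;> by_cases h2 : s.2 = z <;> simp_all [attachBasisVec, Prod.ext_iff]

theorem isState_basisState {d : ℕ} (z : Fin d) : IsState (basisState z) :=
  ⟨posSemidef_ketBra _, by simp [basisState, trace_ketBra]⟩

theorem IsState.kronecker {m n : Type*} [Fintype m] [Fintype n]
    {ρ : Matrix m m ℂ} {σ : Matrix n n ℂ} (hρ : IsState ρ) (hσ : IsState σ) :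
    IsState (ρ ⊗ₖ σ) := by
  classical
  exact ⟨hρ.1.kronecker hσ.1, by rw [Matrix.trace_kronecker, hρ.2, hσ.2, one_mul]⟩

/-- Incoherent operations produce no entanglement `k`-concurrence from states with vanishing
coherence `k`-concurrence. -/
theorem entanglementConcurrence_eq_zero {d k : ℕ} (hk : k ≠ 0) (hkd : k ≤ d)
    {ρ : Matrix (Fin d) (Fin d) ℂ} (hρ : IsState ρ) (z : Fin d)
    {L : Matrix (Fin d × Fin d) (Fin d × Fin d) ℂ →ₗ[ℂ] Matrix (Fin d × Fin d) (Fin d × Fin d) ℂ}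
    (hL : IsIncoherentOperation L) (hC : coherenceConcurrence k ρ = 0) :
    entanglementConcurrence k (L (ρ ⊗ₖ basisState z)) = 0 := by
  have htr := (hL.isState (hρ.kronecker (isState_basisState z))).2
  obtain ⟨N, K, hK, hKi, hLK⟩ := hL
  obtain ⟨m, p, ψ, h, hsum⟩ :=
    exists_isPureDecomposition_convexRoof_eq (continuous_pureCoherenceConcurrence k) hρ
  have hzero : ∀ a, p a * pureCoherenceConcurrence k (ψ a) = 0 := by
    rw [← coherenceConcurrence, hC, eq_comm, Finset.sum_eq_zero_iff_of_nonneg fun a _ =>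
      mul_nonneg (h.nonneg a) (pureCoherenceConcurrence_nonneg k _)] at hsum
    exact fun a => hsum a (Finset.mem_univ a)
  let u : Fin N × Fin m → EuclideanSpace ℂ (Fin d × Fin d) := fun q =>
    WithLp.toLp 2 (K q.1 *ᵥ attachBasisVec z (ψ q.2))
  refine convexRoof_eq_zero_of_eq_sum_ketBra (pureEntanglementConcurrence_nonneg k) htr
    (fun q => ((Real.sqrt (p q.2) : ℝ) : ℂ) • u q) ?_ fun q hq => ?_
  · have hX : ρ ⊗ₖ basisState z = ∑ a, (p a : ℂ) • ketBra (attachBasisVec z (ψ a)) := by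
      simp_rw [ketBra_attachBasisVec]
      ext ⟨i, a⟩ ⟨j, b⟩
      simp [h.eq_sum, Matrix.sum_apply, Finset.sum_mul, mul_assoc]
    rw [hLK, hX, Fintype.sum_prod_type]
    refine Finset.sum_congr rfl fun n _ => ?_
    rw [Finset.mul_sum, Finset.sum_mul]
    refine Finset.sum_congr rfl fun a _ => ?_
    rw [ketBra_smul, ← mul_ketBra_mul_conjTranspose]
    simp [Real.sq_sqrt (h.nonneg a)]
  · have hp : p q.2 ≠ 0 := fun h0 => hq (by simp [h0])
    have hψ := card_support_lt_of_pureCoherenceConcurrence_eq_zero hk hkd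
      ((mul_eq_zero.1 (hzero q.2)).resolve_left hp)
    refine pureEntanglementConcurrence_eq_zero hk
      ((((hKi q.1).card_support_mulVec_le _).trans
        (card_support_attachBasisVec_le z (ψ q.2))).trans_lt hψ) fun r hr => ?_
    rw [PiLp.smul_apply, PiLp.smul_apply, smul_ne_zero_iff, smul_ne_zero_iff] at hr
    exact Finset.mem_filter.2 ⟨Finset.mem_univ _, hr.2.2⟩

/-! ### The copying permutation -/

/-- Conjugation by a permutation of the reference basis. -/
def permConj {ι : Type*} (e : Equiv.Perm ι) : Matrix ι ι ℂ →ₗ[ℂ] Matrix ι ι ℂ :=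
  (Matrix.reindexLinearEquiv ℂ ℂ e e).toLinearMap

theorem isIncoherentOperation_permConj {ι : Type*} [Fintype ι] [DecidableEq ι]
    (e : Equiv.Perm ι) : IsIncoherentOperation (permConj e) := by
  let K : Matrix ι ι ℂ := (1 : Matrix ι ι ℂ).submatrix e.symm id
  have hconj : ∀ X : Matrix ι ι ℂ, K * X * Kᴴ = X.submatrix e.symm e.symm := fun X => by
    ext i j
    simp [K, Matrix.mul_apply, Matrix.one_apply]
  refine ⟨1, fun _ => K, ?_, fun _ δ hδ => ⟨1, zero_le_one, K * δ * Kᴴ, ⟨⟨?_, ?_⟩, ?_⟩, ?_⟩,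
    fun X => ?_⟩
  · ext i j
    simp [K, Matrix.one_apply]
  · exact hδ.1.1.mul_mul_conjTranspose_same _
  · rw [hconj, ← hδ.1.2]
    exact e.symm.sum_comp fun i => δ i i
  · rw [hconj]
    exact fun i j hij => hδ.2 (e.symm.injective.ne hij)
  · simp
  · simp [hconj, permConj]

/-- The permutation of the product reference basis with `|i⟩|z⟩ ↦ |i⟩|i⟩`. -/
def copyPerm {d : ℕ} (z : Fin d) : Equiv.Perm (Fin d × Fin d) :=
  Equiv.prodShear (Equiv.refl _) fun i => Equiv.swap z i

theorem permConj_copyPerm_apply {d : ℕ} (z : Fin d) (ρ : Matrix (Fin d) (Fin d) ℂ)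
    (r s : Fin d × Fin d) : permConj (copyPerm z) (ρ ⊗ₖ basisState z) r s =
      if r.1 = r.2 ∧ s.1 = s.2 then ρ r.1 s.1 else 0 := by
  have hswap : ∀ i j : Fin d, Equiv.swap z i j = z ↔ i = j := fun i j => by
    rw [Equiv.swap_apply_eq_iff, Equiv.swap_apply_left, eq_comm]
  simp [permConj, copyPerm, Equiv.prodShear, basisState_apply, hswap]

/-- The maximally correlated state generated from `ρ` has at least the concurrence of `ρ`. -/
theorem coherenceConcurrence_le_entanglementConcurrence {d k : ℕ} (hk : k ≠ 0) (hkd : k ≤ d)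
    {ρ : Matrix (Fin d) (Fin d) ℂ} (hρ : IsState ρ) (z : Fin d) :
    coherenceConcurrence k ρ ≤
      entanglementConcurrence k (permConj (copyPerm z) (ρ ⊗ₖ basisState z)) := by
  have hσ := (isIncoherentOperation_permConj (copyPerm z)).isState
    (hρ.kronecker (isState_basisState z))
  obtain ⟨m₀, p₀, ψ₀, h₀⟩ := hσ.exists_isPureDecomposition
  refine le_csInf ⟨_, m₀, p₀, ψ₀, h₀, rfl⟩ ?_
  rintro x ⟨m, p, ψ, h, rfl⟩
  have hentry : ∀ r s : Fin d × Fin d, (if r.1 = r.2 ∧ s.1 = s.2 then ρ r.1 s.1 else 0) =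
      ∑ a, (p a : ℂ) * (ψ a r * star (ψ a s)) := fun r s => by
    rw [← permConj_copyPerm_apply z, h.eq_sum]
    simp [Matrix.sum_apply, ketBra]
  -- The diagonal entry of the output at `(i, j)` is zero and is a sum of nonnegative terms `p a *
  -- ‖ψ a (i, j)‖ ^ 2`.
  have hoff : ∀ a, p a ≠ 0 → ∀ i j, i ≠ j → ψ a (i, j) = 0 := fun a ha i j hij => by
    have h1 := hentry (i, j) (i, j)
    rw [if_neg fun hc => hij hc.1] at h1
    have h2 : ∑ a, p a * ‖ψ a (i, j)‖ ^ 2 = 0 := by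
      have : ((∑ a, p a * ‖ψ a (i, j)‖ ^ 2 : ℝ) : ℂ) = 0 := by
        rw [h1, Complex.ofReal_sum]
        exact Finset.sum_congr rfl fun b _ => by simp [Complex.mul_conj, Complex.normSq_eq_norm_sq]
      exact_mod_cast this
    rw [Finset.sum_eq_zero_iff_of_nonneg fun b _ => mul_nonneg (h.nonneg b) (by positivity)] at h2
    simpa [ha] using h2 a (Finset.mem_univ a)
  -- At weight zero `ψ a` may leave the diagonal span and its restriction need not be a unit vector,
  -- hence the default.
  let φ : Fin m → EuclideanSpace ℂ (Fin d) := fun a =>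
    if p a = 0 then EuclideanSpace.single z 1 else WithLp.toLp 2 fun i => ψ a (i, i)
  refine csInf_le ⟨0, ?_⟩ ⟨m, p, φ, ⟨h.nonneg, h.sum_eq_one, fun a => ?_, ?_⟩, ?_⟩
  · rintro x ⟨m, p, ψ, h, rfl⟩
    exact Finset.sum_nonneg fun a _ =>
      mul_nonneg (h.nonneg a) (pureCoherenceConcurrence_nonneg k _)
  · by_cases ha : p a = 0
    · simp [φ, ha]
    · rw [← h.norm_eq_one a, EuclideanSpace.norm_eq, EuclideanSpace.norm_eq, Fintype.sum_prod_type]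
      congr 1
      refine Finset.sum_congr rfl fun i _ => ?_
      rw [Fintype.sum_eq_single i fun j hj => by simp [hoff a ha i j hj.symm]]
      simp [φ, ha]
  · ext i j
    have h1 := hentry (i, i) (j, j)
    simp only [and_self, if_true] at h1
    rw [h1, Matrix.sum_apply]
    refine Finset.sum_congr rfl fun a _ => ?_
    by_cases ha : p a = 0 <;> simp [φ, ha, ketBra]
  · refine Finset.sum_congr rfl fun a _ => ?_
    by_cases ha : p a = 0
    · simp [ha]
    · congr 1
      refine pureEntanglementConcurrence_of_diagonal hk hkd ?_
      ext i j
      by_cases hij : i = j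
      · subst hij
        simp [coeffMatrix, φ, ha]
      · simp [coeffMatrix, hij, hoff a ha i j hij]

/-- The system and the ancilla have reference basis `|1⟩, …, |d⟩`, indexed by `Fin d`, so that `|1⟩`
has index `0`; the reference basis of the composite system is the product basis. -/
theorem theorem3 (d k : ℕ) (hk : 2 ≤ k) (hkd : k ≤ d)
    (ρ : Matrix (Fin d) (Fin d) ℂ) (hρ : IsState ρ) :
    (∃ L : Matrix (Fin d × Fin d) (Fin d × Fin d) ℂ →ₗ[ℂ]
        Matrix (Fin d × Fin d) (Fin d × Fin d) ℂ,
      IsIncoherentOperation L ∧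
        entanglementConcurrence k (L (ρ ⊗ₖ basisState (⟨0, by omega⟩ : Fin d))) ≠ 0) ↔
      coherenceConcurrence k ρ ≠ 0 := by
  have hk0 : k ≠ 0 := by omega
  refine ⟨fun ⟨L, hL, hE⟩ hC => hE (entanglementConcurrence_eq_zero hk0 hkd hρ _ hL hC),
    fun hC => ⟨permConj (copyPerm ⟨0, by omega⟩), isIncoherentOperation_permConj _, ?_⟩⟩
  exact ((lt_of_le_of_ne (convexRoof_nonneg (pureCoherenceConcurrence_nonneg k) ρ)
    hC.symm).trans_le (coherenceConcurrence_le_entanglementConcurrence hk0 hkd hρ _)).ne'
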